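/- Let $\mathrm A\in\mathbb R^{m\times n}$, $b\in\mathbb R^m$, $c\in\mathbb R^n$, $\mathrm B\in\mathbb R^{r\times n}$ and $\mathrm M=\mathrm B^{\intercal}\mathrm B$. Let $\mathcal K=\{x\in\mathbb R^n:\mathrm Ax=b,\ x\ge 0\}$ be nonempty and bounded, and suppose that $x\mapsto-\frac12x^{\intercal}\mathrm Mx+c^{\intercal}x$ is nonconstant on $\mathcal K$. For $x\ge 0$ let $\mathsf H(x)=-\sum_i x_i\log x_i$ (with $0\log 0=0$), and put $$R_{\mathsf H}=\max_{x,x'\in\mathcal K}\{\mathsf H(x)-\mathsf H(x')\},\qquad R_1=\max_{x\in\mathcal K}\|x\|_1 .$$ Let $v^{(1)},\dots,v^{(V)}$ be the vertices (extreme points) of $\mathcal K$. Let $\|\cdot\|$ be the Euclidean norm, $\operatorname{dist}(z,S)=\inf_{z'\in S}\|z-z'\|$, and let minima and infima over the empty set be $+\infty$. For $q\in\mathbb R^n$ let $\mathcal O_q=\operatorname{argmin}_{x\in\mathcal K}q^{\intercal}x$ and $$\kappa_q=\min_{x\in\{v^{(1)},\dots,v^{(V)}\}\setminus\mathcal O_q}q^{\intercal}x-\min_{x\in\mathcal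 O_q}q^{\intercal}x .$$ For $u\in\mathbb R^r$ let $g_0(u)=\frac12\|u\|^2+\min_{x\in\mathcal K}(c-\mathrm B^{\intercal}u)^{\intercal}x$, and for $i\in[V]=\{1,\dots,V\}$ let $$\mathcal C_i=\{u\in\mathbb R^r:(c-\mathrm B^{\intercal}u)^{\intercal}v^{(i)}\le(c-\mathrm B^{\intercal}u)^{\intercal}v^{(j)}\text{ for every }j\ne i\}.$$ Let $\mathcal I^\star=\{i\in[V]:\mathcal C_i\cap\operatorname{argmin}_{u\in\mathbb R^r}g_0(u)\ne\emptyset\}$ and define $$\alpha=\min_{u\in\bigcup_{i\in[V]\setminus\mathcal I^\star}\mathcal C_i}g_0(u)-\min_{u\in\mathbb R^r}g_0(u),\qquad \gamma_i=\operatorname{dist}(\mathrm Bv^{(i)},\mathrm{bd}(\mathcal C_i)),$$ $$\Delta_i=\min\Big\{\kappa_{c-\mathrm B^{\intercal}\mathrm Bv^{(i)}},\ \frac{\gamma_i}{2}\min_{k\in[V]:\,\mathrm Bv^{(k)}\ne\mathrm Bv^{(i)}}\|\mathrm Bv^{(k)}-\mathrm Bv^{(i)}\|\Big\}\qquad(i\in\mathcal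 I^\star),$$ $\gamma=\min_{i\in\mathcal I^\star}\gamma_i$ and $\Delta=\min_{i\in\mathcal I^\star}\Delta_i$. Then $\alpha>0$, $\gamma_i>0$ and $\Delta_i>0$ for every $i\in\mathcal I^\star$, and $0<\Delta<\infty$. Moreover, for every real $\varepsilon$ with $$0<\varepsilon<\min\Big\{\frac{\alpha}{R_{\mathsf H}},\ \frac{\gamma^2}{8R_{\mathsf H}},\ \frac{\Delta}{R_1+R_{\mathsf H}}\Big\}$$ and every minimizer $x^\star_\varepsilon$ of $-\frac12x^{\intercal}\mathrm Mx+c^{\intercal}x-\varepsilon\mathsf H(x)$ over $\mathcal K$, $$\operatorname{dist}\Big(x^\star_\varepsilon,\ \operatorname{argmin}_{x\in\mathcal K}\big\{-\tfrac12x^{\intercal}\mathrm Mx+c^{\intercal}x\big\}\Big)\le 2R_1\exp\Big(\frac{-\Delta}{2\varepsilon R_1}+\frac{R_1+R_{\mathsf H}}{R_1}\Big).$$ -/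

import Mathlib

noncomputable section

namespace EntropicQP

variable {m n r d : ℕ}

/-- The feasible set `{x : A x = b, x ≥ 0}`. -/
def feasibleSet (A : Matrix (Fin m) (Fin n) ℝ) (b : EuclideanSpace ℝ (Fin m)) :
    Set (EuclideanSpace ℝ (Fin n)) :=
  {x | A.toEuclideanLin x = b ∧ ∀ i, 0 ≤ x i}

/-- The entropy `-∑ xᵢ log xᵢ` with `0 log 0 = 0`; it is only evaluated at vectors with
nonnegative entries. -/
def entropy (x : EuclideanSpace ℝ (Fin n)) : ℝ :=
  -∑ i, x i * Real.log (x i)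

/-- The set of minimizers of `f` over `S`. -/
def argmin {X : Type*} (f : X → ℝ) (S : Set X) : Set X :=
  {x | x ∈ S ∧ ∀ y ∈ S, f x ≤ f y}

/-- Euclidean point-to-set distance; the distance to the empty set is `+∞`. -/
def setDist (z : EuclideanSpace ℝ (Fin d)) (C : Set (EuclideanSpace ℝ (Fin d))) : EReal :=
  ⨅ w ∈ C, ((‖z - w‖ : ℝ) : EReal)

/-- The concave quadratic objective `-½ xᵀ M x + cᵀ x`. -/
def quadObj (M : Matrix (Fin n) (Fin n) ℝ) (c x : EuclideanSpace ℝ (Fin n)) : ℝ :=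
  -(1 / 2) * inner ℝ x (M.toEuclideanLin x) + inner ℝ c x

/-- The regularized objective `-½ xᵀ M x + cᵀ x - ε H(x)`. -/
def regObj (M : Matrix (Fin n) (Fin n) ℝ) (c : EuclideanSpace ℝ (Fin n)) (ε : ℝ)
    (x : EuclideanSpace ℝ (Fin n)) : ℝ :=
  quadObj M c x - ε * entropy x

/-- `R_H`, the maximum over `x, x' ∈ K` of `H(x) - H(x')`. -/
def entropyRange (K : Set (EuclideanSpace ℝ (Fin n))) : ℝ :=
  sSup {t | ∃ x ∈ K, ∃ x' ∈ K, t = entropy x - entropy x'}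

/-- `R₁`, the maximum over `x ∈ K` of the 1-norm. -/
def oneNormRadius (K : Set (EuclideanSpace ℝ (Fin n))) : ℝ :=
  sSup {t | ∃ x ∈ K, t = ∑ i, |x i|}

/-- The vertices of `K`. -/
def vertices (K : Set (EuclideanSpace ℝ (Fin n))) : Set (EuclideanSpace ℝ (Fin n)) :=
  Set.extremePoints ℝ K

/-- The solution set of the linear program with cost `q` over `K`. -/
def lpArgmin (K : Set (EuclideanSpace ℝ (Fin n))) (q : EuclideanSpace ℝ (Fin n)) :
    Set (EuclideanSpace ℝ (Fin n)) :=
  argmin (fun x => inner ℝ q x) K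

/-- `κ_q`: the gap between the best value of a non-optimal vertex and the optimal value of the
linear program with cost `q` (`+∞` if every vertex is optimal). -/
def lpGap (K : Set (EuclideanSpace ℝ (Fin n))) (q : EuclideanSpace ℝ (Fin n)) : EReal :=
  (⨅ x ∈ vertices K \ lpArgmin K q, ((inner ℝ q x : ℝ) : EReal)) -
    ⨅ x ∈ lpArgmin K q, ((inner ℝ q x : ℝ) : EReal)

/-- The cost vector `c - Bᵀ u`. -/
def cost (B : Matrix (Fin r) (Fin n) ℝ) (c : EuclideanSpace ℝ (Fin n))
    (u : EuclideanSpace ℝ (Fin r)) : EuclideanSpace ℝ (Fin n) :=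
  c - B.transpose.toEuclideanLin u

/-- The region of all `u` for which the vertex `v` is optimal. -/
def region (K : Set (EuclideanSpace ℝ (Fin n))) (B : Matrix (Fin r) (Fin n) ℝ)
    (c v : EuclideanSpace ℝ (Fin n)) : Set (EuclideanSpace ℝ (Fin r)) :=
  {u | ∀ w ∈ vertices K, w ≠ v → inner ℝ (cost B c u) v ≤ inner ℝ (cost B c u) w}

/-- `g_ε(u) = ½ ‖u‖² + min_{x ∈ K} {(c - Bᵀ u)ᵀ x - ε H(x)}`. -/
def varObj (K : Set (EuclideanSpace ℝ (Fin n))) (B : Matrix (Fin r) (Fin n) ℝ)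
    (c : EuclideanSpace ℝ (Fin n)) (ε : ℝ) (u : EuclideanSpace ℝ (Fin r)) : ℝ :=
  1 / 2 * ‖u‖ ^ 2 + sInf ((fun x => inner ℝ (cost B c u) x - ε * entropy x) '' K)

/-- The vertices whose region contains a global minimizer of `g_0`. -/
def optVertices (K : Set (EuclideanSpace ℝ (Fin n))) (B : Matrix (Fin r) (Fin n) ℝ)
    (c : EuclideanSpace ℝ (Fin n)) : Set (EuclideanSpace ℝ (Fin n)) :=
  {v | v ∈ vertices K ∧ (region K B c v ∩ argmin (varObj K B c 0) Set.univ).Nonempty}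

/-- `α`: the gap between the minimum of `g_0` over the regions of the vertices outside
`optVertices` and its global minimum (`+∞` if the union of those regions is empty). -/
def alpha (K : Set (EuclideanSpace ℝ (Fin n))) (B : Matrix (Fin r) (Fin n) ℝ)
    (c : EuclideanSpace ℝ (Fin n)) : EReal :=
  (⨅ u ∈ ⋃ v ∈ vertices K \ optVertices K B c, region K B c v,
      ((varObj K B c 0 u : ℝ) : EReal)) -
    ⨅ u, ((varObj K B c 0 u : ℝ) : EReal)

/-- `γ_v`: the distance from `B v` to the boundary of the region of `v`. -/
def gammaAt (K : Set (EuclideanSpace ℝ (Fin n))) (B : Matrix (Fin r) (Fin n) ℝ)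
    (c v : EuclideanSpace ℝ (Fin n)) : EReal :=
  setDist (B.toEuclideanLin v) (frontier (region K B c v))

/-- `Δ_v`: the minimum of `κ_{c - Bᵀ B v}` and of `γ_v / 2` times the least nonzero distance
from `B v` to `B w`, over the vertices `w`. -/
def deltaAt (K : Set (EuclideanSpace ℝ (Fin n))) (B : Matrix (Fin r) (Fin n) ℝ)
    (c v : EuclideanSpace ℝ (Fin n)) : EReal :=
  min (lpGap K (cost B c (B.toEuclideanLin v)))
    (gammaAt K B c v / 2 *
      ⨅ w ∈ {w ∈ vertices K | B.toEuclideanLin w ≠ B.toEuclideanLin v},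
        ((‖B.toEuclideanLin w - B.toEuclideanLin v‖ : ℝ) : EReal))

/-- `γ`, the minimum of the `γ_v` over `optVertices`. -/
def gammaMin (K : Set (EuclideanSpace ℝ (Fin n))) (B : Matrix (Fin r) (Fin n) ℝ)
    (c : EuclideanSpace ℝ (Fin n)) : EReal :=
  ⨅ v ∈ optVertices K B c, gammaAt K B c v

/-- `Δ`, the minimum of the `Δ_v` over `optVertices`. -/
def deltaMin (K : Set (EuclideanSpace ℝ (Fin n))) (B : Matrix (Fin r) (Fin n) ℝ)
    (c : EuclideanSpace ℝ (Fin n)) : EReal :=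
  ⨅ v ∈ optVertices K B c, deltaAt K B c v

end EntropicQP

end

noncomputable section

namespace EntropicQP

variable {m n r : ℕ}

/-! Write f for the quadratic objective. Completing the square gives ½‖u‖² + (c − Bᵀu)ᵀx = ½‖u −
Bx‖² + f(x), so g_0(u) is the minimum of the right-hand side over x in K, and the regions are the
cells on which a given vertex attains it. Hence f is minimized at a vertex, I* consists of the
vertices minimizing f, and α > 0. At u = Bv with v optimal, a vertex w with Bw ≠ Bv is worse by at
least ½‖Bv − Bw‖², while Bw = Bv makes the comparison independent of u; so the region of v is a
neighbourhood of Bv and γ_v > 0.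

Let x be a regularized minimizer and u = Bx. A vertex v whose region contains u satisfies ½‖u − Bv‖²
+ f(v) ≤ f(x) ≤ min f + εR_H. The bound on ε by α makes v optimal, and the bound by γ puts u within
γ/2 of Bv. There every vertex either ties with v or costs at least Δ more for the cost c − Bᵀu
(`tie_or_gap`). Split x = a s + b t accordingly; s minimizes f. Comparing x with s gives bΔ ≤ ε(H(x)
− H(s)) ≤ εb(R_H + R_1 − R_1 log b), so b is exponentially small (`weight_le_exp`), and ‖x − s‖ =
b‖t − s‖ ≤ 2R_1 b. -/

/-! ### Completing the square. -/

theorem inner_cost (B : Matrix (Fin r) (Fin n) ℝ) (c x : EuclideanSpace ℝ (Fin n))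
    (u : EuclideanSpace ℝ (Fin r)) :
    inner ℝ (cost B c u) x = inner ℝ c x - inner ℝ u (B.toEuclideanLin x) := by
  have h := Matrix.toEuclideanLin_conjTranspose_eq_adjoint B
  rw [Matrix.conjTranspose_eq_transpose_of_trivial] at h
  rw [cost, inner_sub_left, h, LinearMap.adjoint_inner_left]

theorem quadObj_transpose_mul_self (B : Matrix (Fin r) (Fin n) ℝ)
    (c x : EuclideanSpace ℝ (Fin n)) :
    quadObj (B.transpose * B) c x
      = -(1 / 2) * ‖B.toEuclideanLin x‖ ^ 2 + inner ℝ c x := by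
  have h := Matrix.toEuclideanLin_conjTranspose_eq_adjoint B
  rw [Matrix.conjTranspose_eq_transpose_of_trivial] at h
  have h2 : (B.transpose * B).toEuclideanLin x
      = B.transpose.toEuclideanLin (B.toEuclideanLin x) := by
    simp [Matrix.toLpLin_apply, Matrix.mulVec_mulVec]
  rw [quadObj, h2, h, LinearMap.adjoint_inner_right, real_inner_self_eq_norm_sq]

/-- Completing the square in the variational form of the quadratic objective. -/
theorem half_normSq_add_inner_cost (B : Matrix (Fin r) (Fin n) ℝ)
    (c x : EuclideanSpace ℝ (Fin n)) (u : EuclideanSpace ℝ (Fin r)) :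
    1 / 2 * ‖u‖ ^ 2 + inner ℝ (cost B c u) x
      = 1 / 2 * ‖u - B.toEuclideanLin x‖ ^ 2 + quadObj (B.transpose * B) c x := by
  rw [inner_cost, quadObj_transpose_mul_self, norm_sub_sq_real]
  ring

/-! ### The polytope and its vertices. -/

theorem convex_feasibleSet (A : Matrix (Fin m) (Fin n) ℝ) (b : EuclideanSpace ℝ (Fin m)) :
    Convex ℝ (feasibleSet A b) := by
  rintro x ⟨hx, hx0⟩ y ⟨hy, hy0⟩ s t hs ht hst
  refine ⟨?_, fun i => ?_⟩
  · rw [map_add, map_smul, map_smul, hx, hy, ← add_smul, hst, one_smul]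
  · have := mul_nonneg hs (hx0 i)
    have := mul_nonneg ht (hy0 i)
    simp only [PiLp.add_apply, PiLp.smul_apply, smul_eq_mul]
    positivity

theorem isClosed_feasibleSet (A : Matrix (Fin m) (Fin n) ℝ) (b : EuclideanSpace ℝ (Fin m)) :
    IsClosed (feasibleSet A b) := by
  refine IsClosed.inter (isClosed_eq (LinearMap.continuous_of_finiteDimensional _)
    continuous_const) ?_
  change IsClosed {x : EuclideanSpace ℝ (Fin n) | ∀ i, 0 ≤ x i}
  simp only [Set.ofPred_forall]
  exact isClosed_iInter fun i => isClosed_le continuous_const (by fun_prop)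

/-- A vertex is the only feasible point whose support lies in that of the vertex. -/
theorem eq_of_mem_vertices_of_support_subset {A : Matrix (Fin m) (Fin n) ℝ}
    {b : EuclideanSpace ℝ (Fin m)} {v w : EuclideanSpace ℝ (Fin n)}
    (hv : v ∈ vertices (feasibleSet A b)) (hw : w ∈ feasibleSet A b)
    (h : ∀ i, v i = 0 → w i = 0) : w = v := by
  obtain ⟨⟨hvA, hv0⟩, hext⟩ := hv
  -- A small step from v away from w stays nonnegative: positive coordinates tolerate it and zero
  -- ones do not move. This puts v inside a segment that starts at w.
  have hex : ∃ t : ℝ, 0 < t ∧ ∀ i, 0 ≤ v i + t * (v i - w i) := by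
    have hloc : ∀ i, ∀ᶠ t : ℝ in nhdsWithin 0 (Set.Ioi 0), 0 ≤ v i + t * (v i - w i) := by
      intro i
      rcases (hv0 i).eq_or_lt with h0 | h0
      · refine Filter.Eventually.of_forall fun t => ?_
        simp [← h0, h i h0.symm]
      · have hc : Filter.Tendsto (fun t : ℝ => v i + t * (v i - w i)) (nhdsWithin 0 (Set.Ioi 0))
            (nhds (v i + 0 * (v i - w i))) :=
          ((by fun_prop : Continuous fun t : ℝ => v i + t * (v i - w i)).tendsto 0).mono_left
            nhdsWithin_le_nhds
        have := hc.eventually (lt_mem_nhds (a := 0) (by simpa using h0))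
        exact this.mono fun t ht => ht.le
    have hall := (Filter.eventually_all.2 hloc).and self_mem_nhdsWithin
    obtain ⟨t, ht, ht0⟩ := hall.exists
    exact ⟨t, ht0, ht⟩
  obtain ⟨t, ht, htv⟩ := hex
  have hy : v + t • (v - w) ∈ feasibleSet A b := by
    refine ⟨?_, fun i => by simpa using htv i⟩
    rw [map_add, map_smul, map_sub, hvA, hw.1, sub_self, smul_zero, add_zero]
  refine hext hw hy ⟨t / (1 + t), 1 / (1 + t), by positivity, by positivity, by field_simp; ring, ?_⟩
  ext i
  simp only [PiLp.add_apply, PiLp.smul_apply, PiLp.sub_apply, smul_eq_mul]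
  field_simp
  ring

/-- A vertex is determined by its zero set, and there are finitely many of those. -/
theorem finite_vertices_feasibleSet (A : Matrix (Fin m) (Fin n) ℝ)
    (b : EuclideanSpace ℝ (Fin m)) : (vertices (feasibleSet A b)).Finite := by
  refine Set.Finite.of_finite_image (f := fun x => {i | x i = 0}) (Set.toFinite _) ?_
  intro v hv w hw h
  exact (eq_of_mem_vertices_of_support_subset hv hw.1
    fun i hi => (Set.ext_iff.1 h i).1 hi).symm

/-- Krein–Milman; the closure is redundant because the hull of a finite set is compact. -/
theorem convexHull_vertices_feasibleSet {A : Matrix (Fin m) (Fin n) ℝ}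
    {b : EuclideanSpace ℝ (Fin m)} (hb : Bornology.IsBounded (feasibleSet A b)) :
    convexHull ℝ (vertices (feasibleSet A b)) = feasibleSet A b := by
  have hc : IsCompact (feasibleSet A b) :=
    Metric.isCompact_of_isClosed_isBounded (isClosed_feasibleSet A b) hb
  have h := closure_convexHull_extremePoints hc (convex_feasibleSet A b)
  change closure (convexHull ℝ (vertices _)) = _ at h
  rwa [((finite_vertices_feasibleSet A b).isCompact_convexHull (𝕜 := ℝ)).isClosed.closure_eq] at h

theorem le_inner_of_forall_vertices {K : Set (EuclideanSpace ℝ (Fin n))}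
    (hull : convexHull ℝ (vertices K) = K) {q : EuclideanSpace ℝ (Fin n)} {a : ℝ}
    (h : ∀ w ∈ vertices K, a ≤ inner ℝ q w) {x : EuclideanSpace ℝ (Fin n)} (hx : x ∈ K) :
    a ≤ inner ℝ q x := by
  have hconv : Convex ℝ {x : EuclideanSpace ℝ (Fin n) | a ≤ inner ℝ q x} :=
    convex_halfSpace_ge (innerₛₗ ℝ q).isLinear a
  rw [← hull] at hx
  exact convexHull_min (fun w hw => h w hw) hconv hx

theorem vertices_nonempty {K : Set (EuclideanSpace ℝ (Fin n))}
    (hull : convexHull ℝ (vertices K) = K) (hne : K.Nonempty) : (vertices K).Nonempty := by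
  rwa [← hull, convexHull_nonempty_iff] at hne

theorem exists_vertex_inner_le {K : Set (EuclideanSpace ℝ (Fin n))}
    (hfin : (vertices K).Finite) (hull : convexHull ℝ (vertices K) = K) (hne : K.Nonempty)
    (q : EuclideanSpace ℝ (Fin n)) :
    ∃ v ∈ vertices K, ∀ x ∈ K, (inner ℝ q v : ℝ) ≤ inner ℝ q x := by
  obtain ⟨v, hv, h⟩ := Set.exists_min_image _ (fun x => (inner ℝ q x : ℝ)) hfin
    (vertices_nonempty hull hne)
  exact ⟨v, hv, fun x hx => le_inner_of_forall_vertices hull h hx⟩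

/-! ### Regions, g_0 and the optimal vertices. -/

theorem mem_region_iff {K : Set (EuclideanSpace ℝ (Fin n))}
    (hull : convexHull ℝ (vertices K) = K) {B : Matrix (Fin r) (Fin n) ℝ}
    {c v : EuclideanSpace ℝ (Fin n)} {u : EuclideanSpace ℝ (Fin r)} :
    u ∈ region K B c v ↔
      ∀ x ∈ K, (inner ℝ (cost B c u) v : ℝ) ≤ inner ℝ (cost B c u) x := by
  refine ⟨fun h x hx => le_inner_of_forall_vertices hull (fun w hw => ?_) hx,
    fun h w hw _ => h w hw.1⟩
  by_cases hwv : w = v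
  · rw [hwv]
  · exact h w hw hwv

/-- The term ½‖u‖² is common to both sides, so a region is a power-diagram cell with centres Bx and
weights f(x). -/
theorem mem_region_iff_sq {K : Set (EuclideanSpace ℝ (Fin n))}
    (hull : convexHull ℝ (vertices K) = K) {B : Matrix (Fin r) (Fin n) ℝ}
    {c v : EuclideanSpace ℝ (Fin n)} {u : EuclideanSpace ℝ (Fin r)} :
    u ∈ region K B c v ↔
      ∀ x ∈ K, 1 / 2 * ‖u - B.toEuclideanLin v‖ ^ 2 + quadObj (B.transpose * B) c v
        ≤ 1 / 2 * ‖u - B.toEuclideanLin x‖ ^ 2 + quadObj (B.transpose * B) c x := by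
  simp only [mem_region_iff hull, ← half_normSq_add_inner_cost, add_le_add_iff_left]

/-- The image of a minimizer of the quadratic objective lies in the region of that minimizer. -/
theorem apply_mem_region {K : Set (EuclideanSpace ℝ (Fin n))}
    (hull : convexHull ℝ (vertices K) = K) {B : Matrix (Fin r) (Fin n) ℝ}
    {c v : EuclideanSpace ℝ (Fin n)}
    (h : ∀ x ∈ K, quadObj (B.transpose * B) c v ≤ quadObj (B.transpose * B) c x) :
    B.toEuclideanLin v ∈ region K B c v := (mem_region_iff_sq hull).2 fun y hy => by
  have := h y hy
  have := sq_nonneg ‖B.toEuclideanLin v - B.toEuclideanLin y‖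
  simp only [sub_self, norm_zero]
  linarith

theorem exists_mem_region {K : Set (EuclideanSpace ℝ (Fin n))}
    (hfin : (vertices K).Finite) (hull : convexHull ℝ (vertices K) = K) (hne : K.Nonempty)
    (B : Matrix (Fin r) (Fin n) ℝ) (c : EuclideanSpace ℝ (Fin n))
    (u : EuclideanSpace ℝ (Fin r)) : ∃ v ∈ vertices K, u ∈ region K B c v := by
  obtain ⟨v, hv, h⟩ := exists_vertex_inner_le hfin hull hne (cost B c u)
  exact ⟨v, hv, (mem_region_iff hull).2 h⟩

theorem varObj_zero_of_mem_region {K : Set (EuclideanSpace ℝ (Fin n))}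
    (hull : convexHull ℝ (vertices K) = K) {B : Matrix (Fin r) (Fin n) ℝ}
    {c v : EuclideanSpace ℝ (Fin n)} {u : EuclideanSpace ℝ (Fin r)} (hv : v ∈ vertices K)
    (hu : u ∈ region K B c v) :
    varObj K B c 0 u
      = 1 / 2 * ‖u - B.toEuclideanLin v‖ ^ 2 + quadObj (B.transpose * B) c v := by
  have h : IsLeast ((fun x => (inner ℝ (cost B c u) x : ℝ) - 0 * entropy x) '' K)
      (inner ℝ (cost B c u) v) := by
    refine ⟨⟨v, hv.1, by simp⟩, ?_⟩
    rintro _ ⟨x, hx, rfl⟩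
    simpa using (mem_region_iff hull).1 hu x hx
  rw [varObj, h.csInf_eq, half_normSq_add_inner_cost]

/-- If Bx lies in the region of w, then f(x) ≥ ½‖Bx − Bw‖² + f(w) ≥ f(w), so the best vertex is best
on all of K. -/
theorem exists_vertex_quadObj_le {K : Set (EuclideanSpace ℝ (Fin n))}
    (hfin : (vertices K).Finite) (hull : convexHull ℝ (vertices K) = K) (hne : K.Nonempty)
    (B : Matrix (Fin r) (Fin n) ℝ) (c : EuclideanSpace ℝ (Fin n)) :
    ∃ v ∈ vertices K, ∀ x ∈ K,
      quadObj (B.transpose * B) c v ≤ quadObj (B.transpose * B) c x := by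
  obtain ⟨v, hv, h⟩ := Set.exists_min_image _ (quadObj (B.transpose * B) c) hfin
    (vertices_nonempty hull hne)
  refine ⟨v, hv, fun x hx => ?_⟩
  obtain ⟨w, hw, hwr⟩ := exists_mem_region hfin hull hne B c (B.toEuclideanLin x)
  have h1 := (mem_region_iff_sq hull).1 hwr x hx
  have h2 := h w hw
  have h3 := sq_nonneg ‖B.toEuclideanLin x - B.toEuclideanLin w‖
  simp only [sub_self, norm_zero] at h1
  linarith

/-- The vertices whose region meets the minimizers of `g_0` are those minimizing the quadratic
objective. -/
theorem mem_optVertices_iff {K : Set (EuclideanSpace ℝ (Fin n))}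
    (hfin : (vertices K).Finite) (hull : convexHull ℝ (vertices K) = K) (hne : K.Nonempty)
    {B : Matrix (Fin r) (Fin n) ℝ} {c v : EuclideanSpace ℝ (Fin n)} :
    v ∈ optVertices K B c ↔ v ∈ vertices K ∧
      ∀ x ∈ K, quadObj (B.transpose * B) c v ≤ quadObj (B.transpose * B) c x := by
  refine and_congr_right fun hv => ⟨?_, fun h => ?_⟩
  · rintro ⟨u, hu, -, hmin⟩ x hx
    obtain ⟨w, hw, hwmin⟩ := exists_vertex_quadObj_le hfin hull hne B c
    have hwr : B.toEuclideanLin w ∈ region K B c w := apply_mem_region hull hwmin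
    have h1 := hmin (B.toEuclideanLin w) trivial
    rw [varObj_zero_of_mem_region hull hv hu, varObj_zero_of_mem_region hull hw hwr] at h1
    have h2 := sq_nonneg ‖u - B.toEuclideanLin v‖
    have h3 := hwmin x hx
    simp only [sub_self, norm_zero] at h1
    linarith
  · have hvr : B.toEuclideanLin v ∈ region K B c v := apply_mem_region hull h
    refine ⟨B.toEuclideanLin v, hvr, trivial, fun u _ => ?_⟩
    obtain ⟨w, hw, hwr⟩ := exists_mem_region hfin hull hne B c u
    rw [varObj_zero_of_mem_region hull hv hvr, varObj_zero_of_mem_region hull hw hwr]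
    have := sq_nonneg ‖u - B.toEuclideanLin w‖
    have := h w hw.1
    simp only [sub_self, norm_zero]
    linarith

/-! ### Positivity and finiteness of α, γ and Δ. -/

theorem lt_biInf_of_finite {X : Type*} {S : Set X} (hS : S.Finite) {f : X → EReal} {a : EReal}
    (ha : a < ⊤) (h : ∀ x ∈ S, a < f x) : a < ⨅ x ∈ S, f x := by
  have h1 : a < hS.toFinset.inf f :=
    (Finset.lt_inf_iff ha).2 fun x hx => h x (hS.mem_toFinset.1 hx)
  simpa [Finset.inf_eq_iInf] using h1

variable {K : Set (EuclideanSpace ℝ (Fin n))} {B : Matrix (Fin r) (Fin n) ℝ}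
  {c v w q x : EuclideanSpace ℝ (Fin n)} {u : EuclideanSpace ℝ (Fin r)}

/-- When Bw = Bv the norms cancel: the linear gap is then f(w) − f(v) for every u. -/
theorem inner_cost_sub_inner_cost :
    (inner ℝ (cost B c u) w : ℝ) - inner ℝ (cost B c u) v =
      1 / 2 * ‖u - B.toEuclideanLin w‖ ^ 2 + quadObj (B.transpose * B) c w
        - (1 / 2 * ‖u - B.toEuclideanLin v‖ ^ 2 + quadObj (B.transpose * B) c v) := by
  rw [← half_normSq_add_inner_cost, ← half_normSq_add_inner_cost]
  ring

theorem continuous_inner_cost (x : EuclideanSpace ℝ (Fin n)) :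
    Continuous fun u => (inner ℝ (cost B c u) x : ℝ) := by
  simp only [inner_cost]
  fun_prop

theorem isClosed_region (v : EuclideanSpace ℝ (Fin n)) : IsClosed (region K B c v) := by
  have : region K B c v = ⋂ w ∈ vertices K, ⋂ _ : w ≠ v,
      {u | (inner ℝ (cost B c u) v : ℝ) ≤ inner ℝ (cost B c u) w} := by
    ext u; simp [region]
  rw [this]
  exact isClosed_biInter fun w _ => isClosed_iInter fun _ =>
    isClosed_le (continuous_inner_cost v) (continuous_inner_cost w)

/-- Vertices with the image of v never beat it, whatever u is; the others are strictly worse at Bv,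
hence nearby by continuity, and they are finite in number. -/
theorem region_mem_nhds (hfin : (vertices K).Finite)
    (hmin : ∀ x ∈ K, quadObj (B.transpose * B) c v ≤ quadObj (B.transpose * B) c x) :
    region K B c v ∈ nhds (B.toEuclideanLin v) := by
  have key : ∀ w ∈ vertices K, ∀ᶠ u in nhds (B.toEuclideanLin v),
      (inner ℝ (cost B c u) v : ℝ) ≤ inner ℝ (cost B c u) w := by
    intro w hw
    have hvw := hmin w hw.1
    by_cases hB : B.toEuclideanLin w = B.toEuclideanLin v
    · refine Filter.Eventually.of_forall fun u => ?_
      have := inner_cost_sub_inner_cost (B := B) (c := c) (u := u) (v := v) (w := w)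
      rw [hB] at this
      linarith
    · have hlt : (inner ℝ (cost B c (B.toEuclideanLin v)) v : ℝ)
          < inner ℝ (cost B c (B.toEuclideanLin v)) w := by
        have h1 := inner_cost_sub_inner_cost (B := B) (c := c) (u := B.toEuclideanLin v)
          (v := v) (w := w)
        have h2 : 0 < ‖B.toEuclideanLin v - B.toEuclideanLin w‖ :=
          norm_pos_iff.2 (sub_ne_zero.2 (Ne.symm hB))
        have h3 := pow_pos h2 2
        rw [sub_self, norm_zero] at h1
        linarith
      exact ((continuous_inner_cost v).continuousAt.eventually_lt
        (continuous_inner_cost w).continuousAt hlt).mono fun u hu => hu.le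
  filter_upwards [(Filter.eventually_all_finite hfin).2 key] with u hu w hw _ using hu w hw

theorem gammaAt_pos (hfin : (vertices K).Finite)
    (hmin : ∀ x ∈ K, quadObj (B.transpose * B) c v ≤ quadObj (B.transpose * B) c x) :
    0 < gammaAt K B c v := by
  obtain ⟨ρ, hρ, hball⟩ := Metric.mem_nhds_iff.1 (region_mem_nhds hfin hmin)
  refine lt_of_lt_of_le (EReal.coe_pos.2 hρ) (le_iInf₂ fun w hw => ?_)
  rw [EReal.coe_le_coe_iff]
  by_contra! hlt
  have hwb : w ∈ Metric.ball (B.toEuclideanLin v) ρ := by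
    rwa [Metric.mem_ball', dist_eq_norm]
  exact hw.2 (interior_maximal hball Metric.isOpen_ball hwb)

/-- The closed ball is needed in `tie_or_gap`, where the shifted point may lie at distance exactly
γ_v. -/
theorem closedBall_subset_region (hfin : (vertices K).Finite)
    (hmin : ∀ x ∈ K, quadObj (B.transpose * B) c v ≤ quadObj (B.transpose * B) c x) {ρ : ℝ}
    (hρ : 0 < ρ) (h : (ρ : EReal) ≤ gammaAt K B c v) :
    Metric.closedBall (B.toEuclideanLin v) ρ ⊆ region K B c v := by
  rw [← closure_ball _ hρ.ne']
  refine closure_minimal (Set.Subset.trans ?_ interior_subset) (isClosed_region v)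
  -- The open ball is connected and meets the interior of the region; leaving that interior would
  -- produce a boundary point at distance less than ρ.
  refine (convex_ball _ ρ).isPreconnected.subset_of_closure_inter_subset isOpen_interior
    ⟨_, Metric.mem_ball_self hρ, mem_interior_iff_mem_nhds.2 (region_mem_nhds hfin hmin)⟩ ?_
  rintro w ⟨hwc, hwb⟩
  by_contra hwi
  have hfr : w ∈ frontier (region K B c v) := ⟨closure_mono interior_subset hwc, hwi⟩
  have h1 : gammaAt K B c v ≤ ((‖B.toEuclideanLin v - w‖ : ℝ) : EReal) := iInf₂_le w hfr
  rw [Metric.mem_ball', dist_eq_norm] at hwb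
  exact absurd (EReal.coe_le_coe_iff.1 (h.trans h1)) (not_le.2 hwb)

theorem inner_cost_add (z : EuclideanSpace ℝ (Fin r)) :
    (inner ℝ (cost B c (u + z)) w : ℝ) - inner ℝ (cost B c (u + z)) v =
      (inner ℝ (cost B c u) w - inner ℝ (cost B c u) v)
        - inner ℝ z (B.toEuclideanLin w - B.toEuclideanLin v) := by
  simp only [inner_cost, inner_add_left, inner_sub_right]
  ring

/-- The boundary is nonempty because the region is proper: going far enough in the direction Bw − Bv
makes w beat v. -/
theorem gammaAt_ne_top
    (hvr : B.toEuclideanLin v ∈ region K B c v) (hw : w ∈ vertices K)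
    (hB : B.toEuclideanLin w ≠ B.toEuclideanLin v) : gammaAt K B c v ≠ ⊤ := by
  have hD : 0 < ‖B.toEuclideanLin w - B.toEuclideanLin v‖ ^ 2 :=
    pow_pos (norm_pos_iff.2 (sub_ne_zero.2 hB)) 2
  set D := ‖B.toEuclideanLin w - B.toEuclideanLin v‖ ^ 2 with hDdef
  set a : ℝ := inner ℝ (cost B c (B.toEuclideanLin v)) w
    - inner ℝ (cost B c (B.toEuclideanLin v)) v with ha
  have hne : region K B c v ≠ Set.univ := by
    intro huniv
    -- The factor (a + 1) / D turns the gap a into a − (a + 1) = −1.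
    have hmem : B.toEuclideanLin v + ((a + 1) / D) • (B.toEuclideanLin w - B.toEuclideanLin v)
        ∈ region K B c v := huniv ▸ Set.mem_univ _
    have h1 := hmem w hw fun h => hB (by rw [h])
    have h2 := inner_cost_add (B := B) (c := c) (u := B.toEuclideanLin v) (v := v) (w := w)
      (((a + 1) / D) • (B.toEuclideanLin w - B.toEuclideanLin v))
    rw [real_inner_smul_left, real_inner_self_eq_norm_sq, ← hDdef, div_mul_cancel₀ _ hD.ne',
      ← ha] at h2
    linarith
  obtain ⟨z, hz⟩ := nonempty_frontier_iff.2 ⟨⟨_, hvr⟩, hne⟩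
  exact ne_top_of_le_ne_top (EReal.coe_ne_top _) (iInf₂_le z hz)

theorem iInf_lpArgmin (hv : v ∈ lpArgmin K q) :
    ⨅ x ∈ lpArgmin K q, ((inner ℝ q x : ℝ) : EReal) = ((inner ℝ q v : ℝ) : EReal) :=
  le_antisymm (iInf₂_le v hv) (le_iInf₂ fun x hx => EReal.coe_le_coe_iff.2 (hv.2 x hx.1))

theorem lpGap_pos (hfin : (vertices K).Finite) (hv : v ∈ lpArgmin K q) : 0 < lpGap K q := by
  rw [lpGap, iInf_lpArgmin hv, EReal.sub_pos]
  refine lt_biInf_of_finite hfin.sdiff (EReal.coe_lt_top _) fun w hw => ?_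
  rw [EReal.coe_lt_coe_iff]
  by_contra! hle
  exact hw.2 ⟨hw.1.1, fun y hy => hle.trans (hv.2 y hy)⟩

theorem lpGap_le (hv : v ∈ lpArgmin K q) (hw : w ∈ vertices K)
    (hlt : (inner ℝ q v : ℝ) < inner ℝ q w) :
    lpGap K q ≤ ((inner ℝ q w - inner ℝ q v : ℝ) : EReal) := by
  rw [lpGap, iInf_lpArgmin hv, EReal.coe_sub]
  exact EReal.sub_le_sub (iInf₂_le w ⟨hw, fun h => not_le.2 hlt (h.2 v hv.1)⟩) le_rfl

theorem deltaAt_pos (hfin : (vertices K).Finite) (hull : convexHull ℝ (vertices K) = K)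
    (hv : v ∈ vertices K)
    (hmin : ∀ x ∈ K, quadObj (B.transpose * B) c v ≤ quadObj (B.transpose * B) c x) :
    0 < deltaAt K B c v := by
  have hvr := apply_mem_region hull hmin
  refine lt_min (lpGap_pos hfin ⟨hv.1, (mem_region_iff hull).1 hvr⟩) (EReal.mul_pos ?_ ?_)
  · exact EReal.div_pos (gammaAt_pos hfin hmin) (by norm_num) (EReal.coe_ne_top 2)
  · refine lt_biInf_of_finite (hfin.subset fun w hw => hw.1) EReal.zero_lt_top fun w hw => ?_
    exact EReal.coe_pos.2 (norm_pos_iff.2 (sub_ne_zero.2 hw.2))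

/-- Near the image of an optimal vertex `v`, every vertex either ties with `v` or is worse than
`v` by at least `Δ_v`. -/
theorem tie_or_gap (hfin : (vertices K).Finite) (hull : convexHull ℝ (vertices K) = K)
    (hv : v ∈ vertices K)
    (hmin : ∀ x ∈ K, quadObj (B.transpose * B) c v ≤ quadObj (B.transpose * B) c x) {δ : ℝ}
    (hδ : (δ : EReal) ≤ deltaAt K B c v)
    (hu : ((2 * ‖u - B.toEuclideanLin v‖ : ℝ) : EReal) ≤ gammaAt K B c v)
    (hw : w ∈ vertices K) :
    (B.toEuclideanLin w = B.toEuclideanLin v ∧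
        quadObj (B.transpose * B) c w = quadObj (B.transpose * B) c v) ∨
      δ ≤ inner ℝ (cost B c u) w - inner ℝ (cost B c u) v := by
  have hvr := apply_mem_region hull hmin
  by_cases hB : B.toEuclideanLin w = B.toEuclideanLin v
  · by_cases hf : quadObj (B.transpose * B) c w = quadObj (B.transpose * B) c v
    · exact Or.inl ⟨hB, hf⟩
    right
    -- With equal images the gap at u equals the gap at Bv, which κ bounds below.
    have hlt := lt_of_le_of_ne (hmin w hw.1) (Ne.symm hf)
    have hu' := inner_cost_sub_inner_cost (B := B) (c := c) (u := u) (v := v) (w := w)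
    have hv' := inner_cost_sub_inner_cost (B := B) (c := c) (u := B.toEuclideanLin v)
      (v := v) (w := w)
    rw [hB] at hu' hv'
    have h1 := (hδ.trans (min_le_left _ _)).trans
      (lpGap_le ⟨hv.1, (mem_region_iff hull).1 hvr⟩ hw (by linarith))
    rw [EReal.coe_le_coe_iff] at h1
    linarith
  · right
    have hD : 0 < ‖B.toEuclideanLin w - B.toEuclideanLin v‖ := norm_pos_iff.2 (sub_ne_zero.2 hB)
    have hpos := gammaAt_pos hfin hmin
    obtain ⟨g, hg⟩ : ∃ g : ℝ, (g : EReal) = gammaAt K B c v :=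
      ⟨_, EReal.coe_toReal (gammaAt_ne_top hvr hw hB) (bot_lt_of_lt hpos).ne'⟩
    rw [← hg] at hu hpos
    have hg0 := EReal.coe_pos.1 hpos
    rw [EReal.coe_le_coe_iff] at hu
    have hδ' : δ ≤ g / 2 * ‖B.toEuclideanLin w - B.toEuclideanLin v‖ := by
      rw [← EReal.coe_le_coe_iff, EReal.coe_mul, EReal.coe_div]
      refine (hδ.trans (min_le_right _ _)).trans ?_
      rw [← hg]
      exact mul_le_mul_of_nonneg_left (iInf₂_le w ⟨hw, hB⟩)
        (EReal.coe_nonneg.2 (by positivity : 0 ≤ g / 2))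
    set D := ‖B.toEuclideanLin w - B.toEuclideanLin v‖ with hDdef
    -- A shift of length γ_v/2 towards Bw − Bv stays in the region and lowers the gap by (γ_v/2)‖Bw
    -- − Bv‖, so the gap at u was at least that large.
    have hmem : u + (g / 2 / D) • (B.toEuclideanLin w - B.toEuclideanLin v) ∈ region K B c v := by
      refine closedBall_subset_region hfin hmin hg0 hg.le ?_
      rw [Metric.mem_closedBall, dist_eq_norm, add_sub_right_comm]
      refine (norm_add_le _ _).trans ?_
      rw [norm_smul, ← hDdef, Real.norm_of_nonneg (by positivity), div_mul_cancel₀ _ hD.ne']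
      linarith
    have h1 := hmem w hw fun h => hB (by rw [h])
    have h2 := inner_cost_add (B := B) (c := c) (u := u) (v := v) (w := w)
      ((g / 2 / D) • (B.toEuclideanLin w - B.toEuclideanLin v))
    rw [real_inner_smul_left, real_inner_self_eq_norm_sq, ← hDdef] at h2
    have h3 : g / 2 / D * D ^ 2 = g / 2 * D := by field_simp
    linarith

/-- If all vertices share one image, f is affine on K, and being nonconstant it leaves some vertex
suboptimal, so κ is finite. Otherwise the term with γ_v is finite. -/
theorem deltaAt_ne_top (hull : convexHull ℝ (vertices K) = K)
    (hv : v ∈ vertices K)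
    (hmin : ∀ x ∈ K, quadObj (B.transpose * B) c v ≤ quadObj (B.transpose * B) c x)
    (hpos : 0 < gammaAt K B c v)
    (hnonconst : ∃ x ∈ K, ∃ y ∈ K,
      quadObj (B.transpose * B) c x ≠ quadObj (B.transpose * B) c y) :
    deltaAt K B c v ≠ ⊤ := by
  have hvr := apply_mem_region hull hmin
  by_cases hB : ∀ w ∈ vertices K, B.toEuclideanLin w = B.toEuclideanLin v
  · have hBK : ∀ x ∈ K, B.toEuclideanLin x = B.toEuclideanLin v := by
      intro x hx
      rw [← hull] at hx
      exact convexHull_min (t := {x | B.toEuclideanLin x = B.toEuclideanLin v}) hB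
        ((convex_singleton (𝕜 := ℝ) _).linear_preimage B.toEuclideanLin) hx
    have hex : ∃ w ∈ vertices K, (inner ℝ (cost B c (B.toEuclideanLin v)) v : ℝ)
        < inner ℝ (cost B c (B.toEuclideanLin v)) w := by
      by_contra! hle
      have hle' : ∀ x ∈ K, quadObj (B.transpose * B) c x ≤ quadObj (B.transpose * B) c v := by
        intro x hx
        have h1 := le_inner_of_forall_vertices hull
          (q := -cost B c (B.toEuclideanLin v))
          (a := -(inner ℝ (cost B c (B.toEuclideanLin v)) v : ℝ))
          (fun w hw => by rw [inner_neg_left]; linarith [hle w hw]) hx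
        have h2 := inner_cost_sub_inner_cost (B := B) (c := c) (u := B.toEuclideanLin v)
          (v := v) (w := x)
        rw [hBK x hx] at h2
        rw [inner_neg_left] at h1
        linarith
      obtain ⟨x, hx, y, hy, hxy⟩ := hnonconst
      exact hxy ((le_antisymm (hle' x hx) (hmin x hx)).trans
        (le_antisymm (hle' y hy) (hmin y hy)).symm)
    obtain ⟨w, hw, hlt⟩ := hex
    exact ne_top_of_le_ne_top (EReal.coe_ne_top _) ((min_le_left _ _).trans
      (lpGap_le ⟨hv.1, (mem_region_iff hull).1 hvr⟩ hw hlt))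
  · push Not at hB
    obtain ⟨w, hw, hwB⟩ := hB
    obtain ⟨g, hg⟩ : ∃ g : ℝ, (g : EReal) = gammaAt K B c v :=
      ⟨_, EReal.coe_toReal (gammaAt_ne_top hvr hw hwB) (bot_lt_of_lt hpos).ne'⟩
    rw [← hg] at hpos
    have hg0 := EReal.coe_pos.1 hpos
    have h1 : deltaAt K B c v
        ≤ ((g / 2 * ‖B.toEuclideanLin w - B.toEuclideanLin v‖ : ℝ) : EReal) := by
      refine (min_le_right _ _).trans ?_
      rw [← hg, EReal.coe_mul]
      exact mul_le_mul_of_nonneg_left (iInf₂_le w ⟨hw, hwB⟩)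
        (EReal.coe_nonneg.2 (by positivity : 0 ≤ g / 2))
    exact ne_top_of_le_ne_top (EReal.coe_ne_top _) h1

theorem iInf_varObj (hfin : (vertices K).Finite) (hull : convexHull ℝ (vertices K) = K)
    (hne : K.Nonempty) (hv : v ∈ vertices K)
    (hmin : ∀ x ∈ K, quadObj (B.transpose * B) c v ≤ quadObj (B.transpose * B) c x) :
    ⨅ u, ((varObj K B c 0 u : ℝ) : EReal) = ((quadObj (B.transpose * B) c v : ℝ) : EReal) := by
  refine le_antisymm ((iInf_le _ (B.toEuclideanLin v)).trans_eq ?_) (le_iInf fun u => ?_)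
  · rw [varObj_zero_of_mem_region hull hv (apply_mem_region hull hmin)]
    simp
  · obtain ⟨w, hw, hwr⟩ := exists_mem_region hfin hull hne B c u
    rw [varObj_zero_of_mem_region hull hw hwr, EReal.coe_le_coe_iff]
    have := hmin w hw.1
    have := sq_nonneg ‖u - B.toEuclideanLin w‖
    linarith

/-- On the region of w, g_0 ≥ f(w), and finitely many nonoptimal vertices leave a positive gap above
min f. -/
theorem alpha_pos (hfin : (vertices K).Finite) (hull : convexHull ℝ (vertices K) = K)
    (hne : K.Nonempty) : 0 < alpha K B c := by
  obtain ⟨v, hv, hmin⟩ := exists_vertex_quadObj_le hfin hull hne B c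
  rw [alpha, iInf_varObj hfin hull hne hv hmin, EReal.sub_pos]
  have h1 : ((quadObj (B.transpose * B) c v : ℝ) : EReal)
      < ⨅ w ∈ vertices K \ optVertices K B c,
        ((quadObj (B.transpose * B) c w : ℝ) : EReal) := by
    refine lt_biInf_of_finite hfin.sdiff (EReal.coe_lt_top _) fun w hw => ?_
    rw [EReal.coe_lt_coe_iff]
    by_contra! hle
    exact hw.2 ((mem_optVertices_iff hfin hull hne).2
      ⟨hw.1, fun y hy => hle.trans (hmin y hy)⟩)
  refine h1.trans_le (le_iInf₂ fun u hu => ?_)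
  obtain ⟨w, hw, hu⟩ := Set.mem_iUnion₂.1 hu
  refine (iInf₂_le w hw).trans ?_
  rw [varObj_zero_of_mem_region hull hw.1 hu, EReal.coe_le_coe_iff]
  have := sq_nonneg ‖u - B.toEuclideanLin w‖
  linarith

/-! ### Entropy bounds. -/

theorem entropy_eq_sum_negMulLog (x : EuclideanSpace ℝ (Fin n)) :
    entropy x = ∑ i, Real.negMulLog (x i) := by
  simp [entropy, Real.negMulLog]

theorem continuous_entropy : Continuous (entropy (n := n)) := by
  simp only [funext entropy_eq_sum_negMulLog]
  fun_prop

theorem entropy_sub_le_entropyRange (hK : IsCompact K) {x y : EuclideanSpace ℝ (Fin n)}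
    (hx : x ∈ K) (hy : y ∈ K) : entropy x - entropy y ≤ entropyRange K := by
  refine le_csSup ?_ ⟨x, hx, y, hy, rfl⟩
  obtain ⟨a, ha⟩ := (hK.image continuous_entropy).bddAbove
  obtain ⟨b, hb⟩ := (hK.image continuous_entropy).bddBelow
  refine ⟨a - b, ?_⟩
  rintro _ ⟨x, hx, y, hy, rfl⟩
  have := ha ⟨x, hx, rfl⟩
  have := hb ⟨y, hy, rfl⟩
  linarith

theorem sum_abs_le_oneNormRadius (hK : IsCompact K) (hx : x ∈ K) :
    ∑ i, |x i| ≤ oneNormRadius K := by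
  refine le_csSup ?_ ⟨x, hx, rfl⟩
  have hc : Continuous fun x : EuclideanSpace ℝ (Fin n) => ∑ i, |x i| := by fun_prop
  obtain ⟨a, ha⟩ := (hK.image hc).bddAbove
  refine ⟨a, ?_⟩
  rintro _ ⟨x, hx, rfl⟩
  exact ha ⟨x, hx, rfl⟩

theorem oneNormRadius_pos (hK : IsCompact K) (hnt : K.Nontrivial) : 0 < oneNormRadius K := by
  obtain ⟨x, hx, hx0⟩ := hnt.exists_ne 0
  refine lt_of_lt_of_le ?_ (sum_abs_le_oneNormRadius hK hx)
  obtain ⟨i, hi⟩ : ∃ i, x i ≠ 0 := by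
    by_contra! h
    exact hx0 (by ext i; exact h i)
  exact Finset.sum_pos' (fun _ _ => abs_nonneg _) ⟨i, Finset.mem_univ i, abs_pos.2 hi⟩

theorem negMulLog_add_le {a b : ℝ} (ha : 0 ≤ a) (hb : 0 ≤ b) :
    Real.negMulLog (a + b) ≤ Real.negMulLog a + Real.negMulLog b := by
  rcases ha.eq_or_lt with rfl | ha
  · simp
  rcases hb.eq_or_lt with rfl | hb
  · simp
  have h1 := mul_le_mul_of_nonneg_left (Real.log_le_log ha (by linarith : a ≤ a + b)) ha.le
  have h2 := mul_le_mul_of_nonneg_left (Real.log_le_log hb (by linarith : b ≤ a + b)) hb.le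
  simp only [Real.negMulLog]
  linarith

/-- Subadditivity of −τ log τ in each coordinate, followed by its product rule; the last two terms
are the cost of mixing. -/
theorem entropy_combination_le {s t : EuclideanSpace ℝ (Fin n)} (hs : ∀ i, 0 ≤ s i)
    (ht : ∀ i, 0 ≤ t i) {a b : ℝ} (ha : 0 ≤ a) (hb : 0 ≤ b) :
    entropy (a • s + b • t) ≤ a * entropy s + b * entropy t
      + Real.negMulLog a * ∑ i, s i + Real.negMulLog b * ∑ i, t i := by
  simp only [entropy_eq_sum_negMulLog, Finset.mul_sum, ← Finset.sum_add_distrib]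
  refine Finset.sum_le_sum fun i _ => ?_
  have h := negMulLog_add_le (mul_nonneg ha (hs i)) (mul_nonneg hb (ht i))
  rw [Real.negMulLog_mul, Real.negMulLog_mul] at h
  simp only [PiLp.add_apply, PiLp.smul_apply, smul_eq_mul]
  linarith

theorem norm_le_sum_abs (x : EuclideanSpace ℝ (Fin n)) : ‖x‖ ≤ ∑ i, |x i| := by
  rw [EuclideanSpace.norm_eq]
  refine Real.sqrt_le_iff.2 ⟨Finset.sum_nonneg fun _ _ => abs_nonneg _, ?_⟩
  exact Finset.sum_sq_le_sq_sum_of_nonneg fun _ _ => abs_nonneg _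

/-- The weight of the suboptimal part of a solution of an entropically regularized linear
program is exponentially small. -/
theorem weight_le_exp (hK : IsCompact K) (hK0 : ∀ x ∈ K, ∀ i, 0 ≤ x i)
    (hR : 0 < oneNormRadius K) {s t : EuclideanSpace ℝ (Fin n)} (hs : s ∈ K) (ht : t ∈ K)
    {a b ε δ : ℝ} (ha : 0 ≤ a) (hb : 0 < b) (hab : a + b = 1) (hε : 0 < ε)
    (h : b * δ ≤ ε * (entropy (a • s + b • t) - entropy s)) :
    b ≤ Real.exp (-δ / (ε * oneNormRadius K)
      + (oneNormRadius K + entropyRange K) / oneNormRadius K) := by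
  have hmix := entropy_combination_le (hK0 s hs) (hK0 t ht) ha hb.le
  have hHts := entropy_sub_le_entropyRange hK ht hs
  have hs1 := sum_abs_le_oneNormRadius hK hs
  have ht1 := sum_abs_le_oneNormRadius hK ht
  simp only [abs_of_nonneg (hK0 s hs _), abs_of_nonneg (hK0 t ht _)] at hs1 ht1
  -- Since −a log a ≤ 1 − a = b, this term is linear in b and only −b log b carries a logarithm.
  have h1 : Real.negMulLog a * ∑ i, s i ≤ b * oneNormRadius K := by
    have h0 := Real.negMulLog_nonneg ha (by linarith)
    have h0' := Real.negMulLog_le_one_sub_self ha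
    exact (mul_le_mul_of_nonneg_left hs1 h0).trans
      (mul_le_mul_of_nonneg_right (by linarith) hR.le)
  have h2 : Real.negMulLog b * ∑ i, t i ≤ b * (-Real.log b * oneNormRadius K) := by
    have h0 := Real.negMulLog_nonneg hb.le (by linarith)
    refine (mul_le_mul_of_nonneg_left ht1 h0).trans_eq ?_
    rw [Real.negMulLog]; ring
  have h3 : b * (entropy t - entropy s) ≤ b * entropyRange K :=
    mul_le_mul_of_nonneg_left hHts hb.le
  have h4 : a * entropy s = entropy s - b * entropy s := by
    rw [← eq_sub_iff_add_eq] at hab; rw [hab]; ring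
  have h5 : entropy (a • s + b • t) - entropy s
      ≤ b * (entropyRange K + oneNormRadius K - Real.log b * oneNormRadius K) := by
    linarith
  -- Every term has a factor b; cancelling it isolates log b.
  have h6 : δ ≤ ε * (entropyRange K + oneNormRadius K - Real.log b * oneNormRadius K) := by
    refine le_of_mul_le_mul_left (h.trans ((mul_le_mul_of_nonneg_left h5 hε.le).trans_eq ?_)) hb
    ring
  rw [← Real.log_le_iff_le_exp hb]
  have h7 : -δ / (ε * oneNormRadius K) + (oneNormRadius K + entropyRange K) / oneNormRadius K
      = (-δ + ε * (oneNormRadius K + entropyRange K)) / (ε * oneNormRadius K) := by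
    field_simp
  rw [h7, le_div_iff₀ (by positivity)]
  linarith

/-! ### Localization and the exponential estimate. -/

theorem mul_lt_of_lt_div {e R : ℝ} {a : EReal} (he : 0 < e) (hR : 0 ≤ R)
    (h : (e : EReal) < a / (R : EReal)) : ((e * R : ℝ) : EReal) < a := by
  rcases hR.eq_or_lt with rfl | hR
  -- Division by zero gives 0 in `EReal`, so the hypothesis contradicts 0 < e.
  · rw [EReal.coe_zero, EReal.div_zero, EReal.coe_neg'] at h
    exact absurd he h.not_gt
  · rw [EReal.coe_mul]
    exact (EReal.lt_div_iff (EReal.coe_pos.2 hR) (EReal.coe_ne_top _)).1 h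

theorem coe_le_of_sq_lt {a : ℝ} {g : EReal} (hg : 0 ≤ g)
    (h : ((a ^ 2 : ℝ) : EReal) < g ^ 2) : (a : EReal) ≤ g := by
  induction g with
  | bot => simp at hg
  | top => exact le_top
  | coe g =>
    rw [← EReal.coe_pow, EReal.coe_lt_coe_iff] at h
    exact EReal.coe_le_coe_iff.2 (lt_of_pow_lt_pow_left₀ 2 (EReal.coe_nonneg.1 hg) h).le

/-- A point of `K` splits into a part generated by the vertices with property `P` and a part
generated by the others. -/
theorem exists_split (hull : convexHull ℝ (vertices K) = K)
    (P : EuclideanSpace ℝ (Fin n) → Prop) (hv : v ∈ vertices K) (hP : P v) (hx : x ∈ K) :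
    ∃ s ∈ convexHull ℝ {w ∈ vertices K | P w}, ∃ t ∈ K, ∃ a b : ℝ, 0 ≤ a ∧ 0 ≤ b ∧
      a + b = 1 ∧ x = a • s + b • t ∧
      (b = 0 ∨ t ∈ convexHull ℝ {w ∈ vertices K | ¬ P w}) := by
  have hsep : {w ∈ vertices K | P w} ∪ {w ∈ vertices K | ¬ P w} = vertices K :=
    Set.sep_or.symm.trans (by simp [em])
  have hne : {w ∈ vertices K | P w}.Nonempty := ⟨v, hv, hP⟩
  have hx' := hx
  rw [← hull, ← hsep] at hx'
  rcases Set.eq_empty_or_nonempty {w ∈ vertices K | ¬ P w} with he | hne'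
  · rw [he, Set.union_empty] at hx'
    exact ⟨x, hx', x, hx, 1, 0, zero_le_one, le_rfl, by simp, by simp, Or.inl rfl⟩
  · rw [convexHull_union hne hne'] at hx'
    obtain ⟨s, hs, t, ht, a, b, ha, hb, hab, rfl⟩ := mem_convexJoin.1 hx'
    refine ⟨s, hs, t, ?_, a, b, ha, hb, hab, rfl, Or.inr ht⟩
    rw [← hull]
    exact convexHull_mono (fun w hw => hw.1) ht

/-- A solution of the regularized problem has its image close to that of an optimal vertex. -/
theorem exists_optVertex_near (hfin : (vertices K).Finite)
    (hull : convexHull ℝ (vertices K) = K) (hne : K.Nonempty) (hK : IsCompact K) {ε : ℝ}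
    (hε : 0 < ε) (hα : ((ε * entropyRange K : ℝ) : EReal) < alpha K B c)
    (hx : x ∈ argmin (regObj (B.transpose * B) c ε) K) :
    ∃ v ∈ optVertices K B c,
      ‖B.toEuclideanLin x - B.toEuclideanLin v‖ ^ 2 ≤ 2 * (ε * entropyRange K) := by
  obtain ⟨hxK, hxmin⟩ := hx
  obtain ⟨v, hv, hmin⟩ := exists_vertex_quadObj_le hfin hull hne B c
  -- The bound g_0(Bx) ≤ f(x) ≤ min f + εR_H yields both claims: w is optimal since εR_H < α, and
  -- ½‖Bx − Bw‖² ≤ εR_H.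
  obtain ⟨w, hw, hwr⟩ := exists_mem_region hfin hull hne B c (B.toEuclideanLin x)
  have h1 := (mem_region_iff_sq hull).1 hwr x hxK
  have h2 := hxmin v hv.1
  have h3 := mul_le_mul_of_nonneg_left (entropy_sub_le_entropyRange hK hxK hv.1) hε.le
  simp only [regObj] at h2
  rw [sub_self, norm_zero] at h1
  have h4 := hmin w hw.1
  refine ⟨w, ?_, by linarith⟩
  by_contra hwo
  have h5 : alpha K B c ≤ ((ε * entropyRange K : ℝ) : EReal) := by
    rw [alpha, iInf_varObj hfin hull hne hv hmin]
    refine EReal.sub_le_of_le_add ((iInf₂_le (B.toEuclideanLin x)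
      (Set.mem_iUnion₂.2 ⟨w, ⟨hw, hwo⟩, hwr⟩)).trans ?_)
    rw [varObj_zero_of_mem_region hull hw hwr, ← EReal.coe_add, EReal.coe_le_coe_iff]
    linarith
  exact absurd hα (not_lt.2 h5)

/-- The exponential estimate, with the constants entering through real bounds. -/
theorem setDist_argmin_le (hfin : (vertices K).Finite)
    (hull : convexHull ℝ (vertices K) = K) (hK : IsCompact K) (hK0 : ∀ x ∈ K, ∀ i, 0 ≤ x i)
    (hR : 0 < oneNormRadius K) {ε δ : ℝ} (hε : 0 < ε)
    (hx : x ∈ argmin (regObj (B.transpose * B) c ε) K) (hv : v ∈ vertices K)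
    (hmin : ∀ x ∈ K, quadObj (B.transpose * B) c v ≤ quadObj (B.transpose * B) c x)
    (hδ : (δ : EReal) ≤ deltaAt K B c v)
    (hnear : ((2 * ‖B.toEuclideanLin x - B.toEuclideanLin v‖ : ℝ) : EReal) ≤ gammaAt K B c v) :
    setDist x (argmin (quadObj (B.transpose * B) c) K) ≤
      ((2 * oneNormRadius K * Real.exp (-δ / (ε * oneNormRadius K)
        + (oneNormRadius K + entropyRange K) / oneNormRadius K) : ℝ) : EReal) := by
  obtain ⟨hxK, hxmin⟩ := hx
  obtain ⟨s, hs, t, ht, a, b, ha, hb, hab, hxst, hbt⟩ := exists_split hull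
    (fun w => B.toEuclideanLin w = B.toEuclideanLin v ∧
      quadObj (B.transpose * B) c w = quadObj (B.transpose * B) c v) hv ⟨rfl, rfl⟩ hxK
  have hsK : s ∈ K := by
    rw [← hull]
    exact convexHull_mono (fun w hw => hw.1) hs
  -- Level sets of f need not be convex, so the tie is passed to the hull through the linear data Bx
  -- and cᵀx.
  have hsv : B.toEuclideanLin s = B.toEuclideanLin v ∧ (inner ℝ c s : ℝ) = inner ℝ c v := by
    refine convexHull_min (t := {y | B.toEuclideanLin y = B.toEuclideanLin v ∧
      (inner ℝ c y : ℝ) = inner ℝ c v}) ?_ ?_ hs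
    · rintro w ⟨-, hwB, hwf⟩
      rw [quadObj_transpose_mul_self, quadObj_transpose_mul_self, hwB] at hwf
      exact ⟨hwB, by linarith⟩
    · exact ((convex_singleton (𝕜 := ℝ) _).linear_preimage B.toEuclideanLin).inter
        ((convex_singleton (𝕜 := ℝ) _).linear_preimage (innerₛₗ ℝ c))
  have hsf : quadObj (B.transpose * B) c s = quadObj (B.transpose * B) c v := by
    rw [quadObj_transpose_mul_self, quadObj_transpose_mul_self, hsv.1, hsv.2]
  set u := B.toEuclideanLin x with hu
  have hqs : (inner ℝ (cost B c u) s : ℝ) = inner ℝ (cost B c u) v := by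
    rw [inner_cost, inner_cost, hsv.1, hsv.2]
  -- At u = Bx the linear difference is f(x) − f(s) − ½‖u − Bs‖², which the optimality of x bounds.
  have hopt : (inner ℝ (cost B c u) x : ℝ) - inner ℝ (cost B c u) s
      ≤ ε * (entropy x - entropy s) := by
    have h1 := hxmin s hsK
    have h2 := inner_cost_sub_inner_cost (B := B) (c := c) (u := u) (v := s) (w := x)
    have h3 := sq_nonneg ‖u - B.toEuclideanLin s‖
    rw [← hu, sub_self, norm_zero] at h2
    simp only [regObj] at h1
    linarith
  have hb_le : b ≤ Real.exp (-δ / (ε * oneNormRadius K)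
      + (oneNormRadius K + entropyRange K) / oneNormRadius K) := by
    rcases hb.eq_or_lt with hb0 | hb0
    · rw [← hb0]; exact (Real.exp_pos _).le
    have ht' := hbt.resolve_left hb0.ne'
    have hqt : inner ℝ (cost B c u) v + δ ≤ inner ℝ (cost B c u) t := by
      refine convexHull_min (t := {y | inner ℝ (cost B c u) v + δ ≤ inner ℝ (cost B c u) y})
        ?_ (convex_halfSpace_ge (innerₛₗ ℝ (cost B c u)).isLinear _) ht'
      rintro w ⟨hw, hwn⟩
      have := (tie_or_gap hfin hull hv hmin hδ hnear hw).resolve_left hwn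
      change inner ℝ (cost B c u) v + δ ≤ inner ℝ (cost B c u) w
      linarith
    refine weight_le_exp hK hK0 hR hsK ht ha hb0 hab hε ?_
    rw [← hxst]
    refine le_trans ?_ hopt
    have h1 : (inner ℝ (cost B c u) x : ℝ) - inner ℝ (cost B c u) s
        = b * (inner ℝ (cost B c u) t - inner ℝ (cost B c u) v) := by
      have ha' : a = 1 - b := by linarith
      rw [hxst, inner_add_right, real_inner_smul_right, real_inner_smul_right, hqs, ha']
      ring
    rw [h1]
    exact mul_le_mul_of_nonneg_left (by linarith) hb
  have hmem : s ∈ argmin (quadObj (B.transpose * B) c) K :=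
    ⟨hsK, fun y hy => hsf.le.trans (hmin y hy)⟩
  refine (iInf₂_le s hmem).trans (EReal.coe_le_coe_iff.2 ?_)
  have h1 : x - s = b • (t - s) := by
    have ha' : a = 1 - b := by linarith
    rw [hxst, ha']
    module
  have h2 : ‖t - s‖ ≤ 2 * oneNormRadius K := by
    have := norm_sub_le t s
    have := (norm_le_sum_abs t).trans (sum_abs_le_oneNormRadius hK ht)
    have := (norm_le_sum_abs s).trans (sum_abs_le_oneNormRadius hK hsK)
    linarith
  rw [h1, norm_smul, Real.norm_of_nonneg hb, mul_comm]
  exact mul_le_mul h2 hb_le hb (by positivity)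

end EntropicQP

end

/-! ### The theorem. -/

theorem theorem3 {m n r : ℕ}
    (A : Matrix (Fin m) (Fin n) ℝ) (b : EuclideanSpace ℝ (Fin m))
    (c : EuclideanSpace ℝ (Fin n))
    (M : Matrix (Fin n) (Fin n) ℝ) (B : Matrix (Fin r) (Fin n) ℝ)
    (hM : M = B.transpose * B)
    (K : Set (EuclideanSpace ℝ (Fin n))) (hK : K = EntropicQP.feasibleSet A b)
    (hne : K.Nonempty) (hbdd : Bornology.IsBounded K)
    (hnonconst : ∃ x ∈ K, ∃ y ∈ K, EntropicQP.quadObj M c x ≠ EntropicQP.quadObj M c y) :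
    0 < EntropicQP.alpha K B c ∧
    (∀ v ∈ EntropicQP.optVertices K B c,
      0 < EntropicQP.gammaAt K B c v ∧ 0 < EntropicQP.deltaAt K B c v) ∧
    0 < EntropicQP.deltaMin K B c ∧ EntropicQP.deltaMin K B c ≠ ⊤ ∧
    ∀ ε : ℝ, 0 < ε →
      (ε : EReal) < min (EntropicQP.alpha K B c / (EntropicQP.entropyRange K : EReal))
        (min (EntropicQP.gammaMin K B c ^ 2 / ((8 * EntropicQP.entropyRange K : ℝ) : EReal))
          (EntropicQP.deltaMin K B c /
            ((EntropicQP.oneNormRadius K + EntropicQP.entropyRange K : ℝ) : EReal))) →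
      ∀ x ∈ EntropicQP.argmin (EntropicQP.regObj M c ε) K,
        EntropicQP.setDist x (EntropicQP.argmin (EntropicQP.quadObj M c) K) ≤
          ((2 * EntropicQP.oneNormRadius K *
            Real.exp (-(EntropicQP.deltaMin K B c).toReal / (2 * ε * EntropicQP.oneNormRadius K)
              + (EntropicQP.oneNormRadius K + EntropicQP.entropyRange K) /
                EntropicQP.oneNormRadius K) : ℝ) : EReal) := by
  subst hM
  have hfin : (EntropicQP.vertices K).Finite := hK ▸ EntropicQP.finite_vertices_feasibleSet A b
  have hull : convexHull ℝ (EntropicQP.vertices K) = K := by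
    subst hK
    exact EntropicQP.convexHull_vertices_feasibleSet hbdd
  have hcpt : IsCompact K :=
    Metric.isCompact_of_isClosed_isBounded (hK ▸ EntropicQP.isClosed_feasibleSet A b) hbdd
  have hK0 : ∀ x ∈ K, ∀ i, 0 ≤ x i := fun x hx => (hK ▸ hx : x ∈ EntropicQP.feasibleSet A b).2
  have hopt {v : EuclideanSpace ℝ (Fin n)} (hv : v ∈ EntropicQP.optVertices K B c) :=
    (EntropicQP.mem_optVertices_iff hfin hull hne).1 hv
  have hγ : ∀ v ∈ EntropicQP.optVertices K B c, 0 < EntropicQP.gammaAt K B c v :=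
    fun v hv => EntropicQP.gammaAt_pos hfin (hopt hv).2
  have hΔ : ∀ v ∈ EntropicQP.optVertices K B c, 0 < EntropicQP.deltaAt K B c v :=
    fun v hv => EntropicQP.deltaAt_pos hfin hull (hopt hv).1 (hopt hv).2
  have hΔpos : 0 < EntropicQP.deltaMin K B c :=
    EntropicQP.lt_biInf_of_finite (hfin.subset fun v hv => hv.1) EReal.zero_lt_top hΔ
  have hΔtop : EntropicQP.deltaMin K B c ≠ ⊤ := by
    obtain ⟨v, hv, hmin⟩ := EntropicQP.exists_vertex_quadObj_le hfin hull hne B c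
    have hvo := (EntropicQP.mem_optVertices_iff hfin hull hne).2 ⟨hv, hmin⟩
    exact ne_top_of_le_ne_top
      (EntropicQP.deltaAt_ne_top hull hv hmin (hγ v hvo) hnonconst) (iInf₂_le v hvo)
  refine ⟨EntropicQP.alpha_pos hfin hull hne, fun v hv => ⟨hγ v hv, hΔ v hv⟩, hΔpos, hΔtop, ?_⟩
  intro ε hε hlt x hx
  have hRH : 0 ≤ EntropicQP.entropyRange K := by
    obtain ⟨y, hy⟩ := hne
    simpa using EntropicQP.entropy_sub_le_entropyRange hcpt hy hy
  have hR1 : 0 < EntropicQP.oneNormRadius K := by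
    obtain ⟨y, hy, z, hz, hyz⟩ := hnonconst
    exact EntropicQP.oneNormRadius_pos hcpt ⟨y, hy, z, hz, fun h => hyz (by rw [h])⟩
  have hα := EntropicQP.mul_lt_of_lt_div hε hRH (lt_of_lt_of_le hlt (min_le_left _ _))
  have hγε := EntropicQP.mul_lt_of_lt_div hε (by positivity)
    (lt_of_lt_of_le hlt ((min_le_right _ _).trans (min_le_left _ _)))
  obtain ⟨v, hvo, hnear⟩ := EntropicQP.exists_optVertex_near hfin hull hne hcpt hε hα hx
  have hnear' : ((2 * ‖B.toEuclideanLin x - B.toEuclideanLin v‖ : ℝ) : EReal)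
      ≤ EntropicQP.gammaAt K B c v := by
    -- Here (2‖Bx − Bv‖)² ≤ 8εR_H < γ², whence the 8 in the bound on ε.
    refine (EntropicQP.coe_le_of_sq_lt (le_iInf₂ fun w hw => (hγ w hw).le)
      (lt_of_le_of_lt (EReal.coe_le_coe_iff.2 ?_) hγε)).trans (iInf₂_le v hvo)
    rw [mul_pow]
    linarith
  have hδ : ((EntropicQP.deltaMin K B c).toReal : EReal) = EntropicQP.deltaMin K B c :=
    EReal.coe_toReal hΔtop (bot_lt_of_lt hΔpos).ne'
  refine (EntropicQP.setDist_argmin_le hfin hull hcpt hK0 hR1 hε hx (hopt hvo).1 (hopt hvo).2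
    (hδ.le.trans (iInf₂_le v hvo)) hnear').trans (EReal.coe_le_coe_iff.2 ?_)
  have hδ0 : 0 < (EntropicQP.deltaMin K B c).toReal := by
    rw [← EReal.coe_pos, hδ]
    exact hΔpos
  -- The estimate obtained has exponent −Δ/(εR_1); since Δ > 0, halving that term only weakens it.
  gcongr 2 * EntropicQP.oneNormRadius K * Real.exp (?_ + _)
  rw [neg_div, neg_div]
  gcongr
  linarith
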